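/- **Setting.** All systems are finite-dimensional. A *semiquantum nonlocal game* consists of finite sets $S,T$ and finite non-empty sets $X,Y$, probability distributions $p$ on $S$ and $q$ on $T$, states (density matrices) $\zeta^s$ ($s\in S$) on a Hilbert space $\mathcal K$ and $\eta^t$ ($t\in T$) on a Hilbert space $\mathcal L$, and a payoff function $\mathfrak p:S\times T\times X\times Y\to\mathbb R$. Two players who share a state $\rho$ on $\mathcal H_A\otimes\mathcal H_B$ choose POVMs $(P^x)_{x\in X}$ on $\mathcal K\otimes\mathcal H_A$ and $(Q^y)_{y\in Y}$ on $\mathcal H_B\otimes\mathcal L$; their average payoff is $$\sum_{s,t,x,y}p(s)q(t)\,\mathfrak p(s,t,x,y)\,\mathrm{Tr}\big[(P^x\otimes Q^y)(\zeta^s\otimes\rho\otimes\eta^t)\big].$$ The maximal payoff $\mathcal P(\rho)$ is the supremum of the average payoff over all such POVMs. Given a set $\mathcal R$ of POVMs (with finite outcome sets) on $\mathcal H_A\otimes\mathcal H_B$, the restricted maximal payoff $\mathcal P_{\mathcal R}(\rho)$ is the supremum over those $(P^x),(Q^y)$ for which, for all $s,t$, the effective POVM on $\mathcal H_A\otimes\mathcal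 H_B$ with outcomes in $X\times Y$ and elements $\mathrm{Tr}_{\mathcal K\mathcal L}\big[(P^x\otimes Q^y)(\zeta^s\otimes 1\otimes\eta^t)\big]$ belongs to $\mathcal R$ (with value $-\infty$ if there are none). A state $\sigma$ is transformed into $\tau$ by *local operations and shared randomness* (LOSR) if $\tau=\sum_i\nu_i\,(D_i\otimes F_i)(\sigma)$ for a finite probability distribution $\nu$ and quantum channels $D_i$, $F_i$ acting on the first and on the second system. Fix a family of bipartite systems (for example one fixed space $\mathcal H_A\otimes\mathcal H_B$, or all finite-dimensional ones), and let $E$ be an extended-real-valued function on the states of these systems that does not increase under LOSR: $E(\tau)\le E(\sigma)$ whenever $\sigma$ is transformed into $\tau$ by LOSR. For a state $\rho$ of a system in the family and a set $\mathcal R$ of POVMs on that system, let $\mathcal E$ be the set of all states $\bar\sigma$ of systems in the family with $\mathcal P(\bar\sigma)\ge\mathcal P_{\mathcal R}(\rho)$ for every semiquantum nonlocal game, and define the effective entanglement $\bar E(\rho)=\inf\{E(\bar\sigma):\bar\sigma\in\mathcal E\}$. **Theorem.** If $\bar\rho$ is a state of a system in the family such that $\mathcal P(\bar\rho)=\mathcal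 P_{\mathcal R}(\rho)$ for every semiquantum nonlocal game, then $\bar E(\rho)=E(\bar\rho)$. -/

import Mathlib

open scoped Kronecker ComplexOrder

namespace Semiquantum

/-- A state of a finite-dimensional quantum system with orthonormal basis indexed by `n`:
a density matrix. -/
structure State (n : Type*) [Fintype n] where
  mat : Matrix n n ℂ
  posSemidef : mat.PosSemidef
  trace_eq_one : mat.trace = 1

/-- A positive operator-valued measure with finite outcome set `Ω`. -/
structure POVM (Ω n : Type*) [Fintype Ω] [Fintype n] [DecidableEq n] where
  effect : Ω → Matrix n n ℂ
  posSemidef : ∀ ω, (effect ω).PosSemidef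
  sum_eq_one : ∑ ω, effect ω = 1

/-- A quantum channel (completely positive trace-preserving map), given by Kraus operators. -/
structure Channel (m n : Type*) [Fintype m] [DecidableEq m] [Fintype n] where
  rank : ℕ
  kraus : Fin rank → Matrix n m ℂ
  sum_eq_one : ∑ j, (kraus j).conjTranspose * kraus j = 1

/-- The action of the local operation `D ⊗ F` on a bipartite operator. -/
noncomputable def localApply {A B A' B' : Type*} [Fintype A] [DecidableEq A] [Fintype B]
    [DecidableEq B] [Fintype A'] [Fintype B'] (D : Channel A A') (F : Channel B B')
    (M : Matrix (A × B) (A × B) ℂ) : Matrix (A' × B') (A' × B') ℂ :=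
  ∑ j, ∑ k, (D.kraus j ⊗ₖ F.kraus k) * M * (D.kraus j ⊗ₖ F.kraus k).conjTranspose

/-- `σ` can be transformed into `τ` by local operations and shared randomness:
with a probability `ν i` that does not depend on the state, Alice and Bob apply `D i ⊗ F i`. -/
def LOSRConvertible {A B A' B' : Type*} [Fintype A] [DecidableEq A] [Fintype B]
    [DecidableEq B] [Fintype A'] [Fintype B'] (σ : State (A × B)) (τ : State (A' × B')) : Prop :=
  ∃ (N : ℕ) (ν : Fin N → ℝ) (D : Fin N → Channel A A') (F : Fin N → Channel B B'),
    (∀ i, 0 ≤ ν i) ∧ ∑ i, ν i = 1 ∧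
      τ.mat = ∑ i, (ν i : ℂ) • localApply (D i) (F i) σ.mat

/-- A semiquantum nonlocal game. Alice receives the question state `ζ s` on the system `K` with
probability `p s`, Bob receives `η t` on the system `L` with probability `q t`; the answers
`x`, `y` are paid with `payoff s t x y`. -/
structure Game where
  (S T X Y K L : Type)
  [fintypeS : Fintype S]
  [fintypeT : Fintype T]
  [fintypeX : Fintype X]
  [fintypeY : Fintype Y]
  [fintypeK : Fintype K]
  [fintypeL : Fintype L]
  [decEqK : DecidableEq K]
  [decEqL : DecidableEq L]
  [nonemptyX : Nonempty X]
  [nonemptyY : Nonempty Y]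
  p : S → ℝ
  q : T → ℝ
  p_nonneg : ∀ s, 0 ≤ p s
  q_nonneg : ∀ t, 0 ≤ q t
  p_sum : ∑ s, p s = 1
  q_sum : ∑ t, q t = 1
  ζ : S → State K
  η : T → State L
  payoff : S → T → X → Y → ℝ

attribute [instance] Game.fintypeS Game.fintypeT Game.fintypeX Game.fintypeY Game.fintypeK
  Game.fintypeL Game.decEqK Game.decEqL Game.nonemptyX Game.nonemptyY

section Games

variable {A B K L : Type*} [Fintype A] [Fintype B] [Fintype K] [Fintype L]

/-- The operator `ζ ⊗ ρ ⊗ η`, with the tensor factors grouped into Alice's systems `K × A` and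
Bob's systems `B × L`. -/
def jointOperator (ζ : Matrix K K ℂ) (ρ : Matrix (A × B) (A × B) ℂ) (η : Matrix L L ℂ) :
    Matrix ((K × A) × (B × L)) ((K × A) × (B × L)) ℂ :=
  let e : (K × A) × (B × L) → (K × (A × B)) × L :=
    fun i => ((i.1.1, (i.1.2, i.2.1)), i.2.2)
  ((ζ ⊗ₖ ρ) ⊗ₖ η).submatrix e e

/-- The effective operator of the joint operator `M` on the shared system `A × B` alone, when the
question systems are in the state `ζ ⊗ η`: the partial trace of `M (ζ ⊗ 1 ⊗ η)` over `K`
and `L`. -/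
noncomputable def effectiveOperator [DecidableEq A] [DecidableEq B]
    (M : Matrix ((K × A) × (B × L)) ((K × A) × (B × L)) ℂ)
    (ζ : Matrix K K ℂ) (η : Matrix L L ℂ) : Matrix (A × B) (A × B) ℂ :=
  Matrix.of fun i j =>
    ∑ k, ∑ l, (M * jointOperator ζ (1 : Matrix (A × B) (A × B) ℂ) η)
      ((k, i.1), (i.2, l)) ((k, j.1), (j.2, l))

variable [DecidableEq A] [DecidableEq B]

/-- The joint conditional probability `μ(x, y | s, t)` when Alice measures `P` on her question and
her share of `ρ`, and Bob measures `Q` on his share of `ρ` and his question. -/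
noncomputable def Game.prob (G : Game) (ρ : State (A × B)) (P : POVM G.X (G.K × A))
    (Q : POVM G.Y (B × G.L)) (s : G.S) (t : G.T) (x : G.X) (y : G.Y) : ℝ :=
  ((P.effect x ⊗ₖ Q.effect y) * jointOperator (G.ζ s).mat ρ.mat (G.η t).mat).trace.re

/-- The average payoff of the measurements `P`, `Q`. -/
noncomputable def Game.averagePayoff (G : Game) (ρ : State (A × B)) (P : POVM G.X (G.K × A))
    (Q : POVM G.Y (B × G.L)) : ℝ :=
  ∑ s, ∑ t, ∑ x, ∑ y, G.p s * G.q t * G.payoff s t x y * G.prob ρ P Q s t x y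

/-- The maximal average payoff with unrestricted measurements. -/
noncomputable def Game.maxPayoff (G : Game) (ρ : State (A × B)) : EReal :=
  ⨆ (P : POVM G.X (G.K × A)) (Q : POVM G.Y (B × G.L)), (G.averagePayoff ρ P Q : EReal)

/-- A set of POVMs on a given system, with arbitrary finite outcome sets. -/
abbrev POVMSet (n : Type*) [Fintype n] [DecidableEq n] :=
  (Ω : Type) → [Fintype Ω] → Set (POVM Ω n)

/-- The measurements `P`, `Q` are admissible for the restriction `R` if, for all questions of the
game, the effective POVM on the shared state alone belongs to `R`. -/
def Game.Admissible (G : Game) (R : POVMSet (A × B)) (P : POVM G.X (G.K × A))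
    (Q : POVM G.Y (B × G.L)) : Prop :=
  ∀ s t, ∃ M ∈ R (G.X × G.Y), ∀ x y,
    M.effect (x, y) =
      effectiveOperator (P.effect x ⊗ₖ Q.effect y) (G.ζ s).mat (G.η t).mat

/-- The maximal average payoff with measurements restricted to `R`
(`⊥` if no measurements are admissible). -/
noncomputable def Game.restrictedMaxPayoff (G : Game) (R : POVMSet (A × B))
    (ρ : State (A × B)) : EReal :=
  ⨆ (P : POVM G.X (G.K × A)) (Q : POVM G.Y (B × G.L)) (_ : G.Admissible R P Q),
    (G.averagePayoff ρ P Q : EReal)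

end Games

section EffectiveEntanglement

/- `A i`, `B i` (`i : ι`) are the bipartite systems under consideration. A one-point `ι` gives
the states on one fixed bipartite Hilbert space; `ι` may also run through all pairs of finite
dimensions. -/
variable {ι : Type*} {A B : ι → Type*} [∀ i, Fintype (A i)] [∀ i, DecidableEq (A i)]
  [∀ i, Fintype (B i)] [∀ i, DecidableEq (B i)]

/-- `E` does not increase under local operations and shared randomness. -/
def LOSRMonotone (E : (i : ι) → State (A i × B i) → EReal) : Prop :=
  ∀ (i j : ι) (σ : State (A i × B i)) (τ : State (A j × B j)),
    LOSRConvertible σ τ → E j τ ≤ E i σ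

/-- The set of all states which, with unrestricted measurements, play every semiquantum nonlocal
game at least as well as `ρ` does with measurements restricted to `R`. -/
def sufficientStates {i : ι} (R : POVMSet (A i × B i)) (ρ : State (A i × B i)) :
    Set (Σ j : ι, State (A j × B j)) :=
  {σ | ∀ G : Game, G.restrictedMaxPayoff R ρ ≤ G.maxPayoff σ.2}

/-- The effective entanglement of `ρ` for measurements restricted to `R`. -/
noncomputable def effectiveEntanglement (E : (i : ι) → State (A i × B i) → EReal) {i : ι}
    (R : POVMSet (A i × B i)) (ρ : State (A i × B i)) : EReal :=
  sInf ((fun σ : Σ j : ι, State (A j × B j) => E σ.1 σ.2) '' sufficientStates R ρ)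

end EffectiveEntanglement

end Semiquantum

/-! The inequality `≤` is immediate, since `ρbar` itself is among the competitors in the infimum.
For `≥`, every competitor `σ` is at least as good as `ρbar` in all games. Buscemi's theorem
(`losrConvertible_of_forall_maxPayoff_le`) turns this into an LOSR transformation of `σ` into
`ρbar`, and monotonicity gives `E ρbar ≤ E σ`.

Buscemi's theorem is proved by separation. Let both players teleport their halves of `σ`, with
arbitrary measurements in place of the Bell measurements and the usual unitary corrections. Every
output is a local image of `σ` (`exists_localApply_eq_teleport`), and the convex hull of the outputs
is compact. If the target `τ` lay outside this hull, some real functional `f` would be strictly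
larger at `τ` than on the hull. Expanding the maximally entangled resource as a sum of products `ζ s
⊗ R s` with question states `ζ s` makes the output linear in the outcome probabilities
(`sum_trace_smul_eq_teleport`), so `f` of the output is the average payoff of a game
(`averagePayoff_teleportGame`). There `τ` attains `f τ` by Bell measurements
(`teleport_bellMeasurement`), while `σ` stays below, a contradiction. -/

namespace Semiquantum

open Matrix

/-! ### Frames of states -/

/-- A positive semidefinite matrix is a multiple of a state. -/
lemma exists_state_smul_eq {K : Type*} [Fintype K] [DecidableEq K] [Nonempty K]
    {M : Matrix K K ℂ} (hM : M.PosSemidef) : ∃ (c : ℂ) (ζ : State K), M = c • ζ.mat := by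
  -- Trace zero forces `M = 0`, and any state serves with coefficient `0`. Polarization meets this
  -- case for the vector `e_a - e_a`.
  by_cases h : M.trace = 0
  · obtain ⟨k⟩ := ‹Nonempty K›
    refine ⟨0, ⟨vecMulVec (Pi.single k 1) (star (Pi.single k 1)),
      posSemidef_vecMulVec_self_star _, ?_⟩, ?_⟩
    · simp [trace_vecMulVec]
    · rw [hM.trace_eq_zero_iff] at h
      simp [h]
  · have h0 : 0 ≤ M.trace⁻¹ := by
      have := hM.trace_nonneg
      rw [Complex.nonneg_iff] at this
      have e : M.trace = (M.trace.re : ℂ) := Complex.ext rfl (by simp [← this.2])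
      rw [e, ← Complex.ofReal_inv]
      exact_mod_cast inv_nonneg.2 this.1
    refine ⟨M.trace, ⟨M.trace⁻¹ • M, hM.smul h0, ?_⟩, ?_⟩
    · simp [trace_smul, h]
    · simp [smul_smul, h]

/-- Polarization: a finite family of states with a dual family of matrices. -/
lemma exists_state_dual_frame (K : Type) [Fintype K] [DecidableEq K] [Nonempty K] :
    ∃ (ζ : K × K × Fin 4 → State K) (C : K × K × Fin 4 → Matrix K K ℂ),
      ∀ i j k l, ∑ s, (ζ s).mat i j * C s k l = if i = k ∧ j = l then 1 else 0 := by
  -- With `v = e_a + I^m e_b`, polarization reads `|a⟩⟨b| = ¼ ∑ₘ I^m v v*`.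
  let v : K × K × Fin 4 → K → ℂ := fun s =>
    Pi.single s.1 1 + (Complex.I ^ (s.2.2 : ℕ)) • Pi.single s.2.1 1
  choose c ζ hζ using fun s => exists_state_smul_eq (posSemidef_vecMulVec_self_star (v s))
  refine ⟨ζ, fun s => ((Complex.I ^ (s.2.2 : ℕ)) / 4 * c s) • single s.1 s.2.1 1, ?_⟩
  intro i j k l
  have h : ∀ s, c s * (ζ s).mat i j = v s i * star (v s j) := fun s => by
    have := congrFun (congrFun (hζ s) i) j
    simpa [vecMulVec_apply] using this.symm
  have : ∀ s, (ζ s).mat i j * (((Complex.I ^ (s.2.2 : ℕ)) / 4 * c s) • single s.1 s.2.1 (1 : ℂ)) k l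
      = if s.1 = k then (if s.2.1 = l then
          Complex.I ^ (s.2.2 : ℕ) / 4 * (v s i * star (v s j)) else 0) else 0 := by
    intro s
    rw [← h s, Matrix.smul_apply, single_apply, smul_eq_mul]
    split_ifs <;> first | (simp_all; done) | ring
  simp_rw [this, Fintype.sum_prod_type]
  simp only [Finset.sum_ite_eq', Finset.mem_univ, if_true, Finset.sum_ite_irrel,
    Finset.sum_const_zero, Fin.sum_univ_four]
  have hstar : ∀ (p : Prop) [Decidable p], star (if p then (1 : ℂ) else 0) = if p then 1 else 0 :=
    fun p _ => by split_ifs <;> simp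
  have hite : (if i = k ∧ j = l then (1 : ℂ) else 0) =
      (if i = k then 1 else 0) * (if j = l then 1 else 0) := by
    rw [ite_and]; split_ifs <;> simp
  have hI : star Complex.I = -Complex.I := Complex.conj_I
  simp only [v, Pi.add_apply, Pi.smul_apply, Pi.single_apply, smul_eq_mul, star_add, star_mul',
    star_pow, hstar, hite, hI]
  generalize (if i = k then (1 : ℂ) else 0) = p
  generalize (if i = l then (1 : ℂ) else 0) = q
  generalize (if j = k then (1 : ℂ) else 0) = r
  generalize (if j = l then (1 : ℂ) else 0) = u
  have h3 : ((3 : Fin 4) : ℕ) = 3 := rfl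
  simp only [Fin.val_zero, Fin.val_one, Fin.val_two, h3, pow_zero, pow_one, neg_sq, Complex.I_sq,
    Complex.I_pow_three, Odd.neg_pow (by decide : Odd 3)]
  linear_combination ((q * r - p * u) / 2) * Complex.I_sq

/-! ### Orthogonal bases of unitaries -/

/-- Unitaries from a space with basis `K` to one with basis `A` which form an orthogonal basis
of the matrix space. -/
structure UnitaryBasis (A K X : Type*) [Fintype A] [DecidableEq A] [Fintype K] [DecidableEq K]
    [Fintype X] where
  mat : X → Matrix A K ℂ
  conjTranspose_mul : ∀ x, (mat x)ᴴ * mat x = 1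
  mul_conjTranspose : ∀ x, mat x * (mat x)ᴴ = 1
  complete : ∀ a a' k k', ∑ x, mat x a k * star (mat x a' k') =
    if a = a' ∧ k = k' then (Fintype.card A : ℂ) else 0
  card_index : Fintype.card X = Fintype.card A ^ 2
  card_right : Fintype.card K = Fintype.card A

/-- The unitary basis of shift and phase operators of a finite abelian group. -/
noncomputable def weylBasis {A G : Type*} [Fintype A] [DecidableEq A] [AddCommGroup G] [Fintype G]
    [DecidableEq G] (e : A ≃ G) : UnitaryBasis A G (G × AddChar G ℂ) where
  mat x := of fun a k => if e a = k + x.1 then x.2 k else 0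
  conjTranspose_mul x := by
    ext k k'
    simp only [mul_apply, conjTranspose_apply, of_apply, one_apply]
    rw [Finset.sum_eq_single (e.symm (k + x.1))]
    · by_cases h : k = k'
      · subst h
        simp [Complex.conj_mul', AddChar.norm_apply]
      · simp [h]
    · intro a _ ha
      have : e a ≠ k + x.1 := fun h => ha (by simp [← h])
      simp [this]
    · simp
  mul_conjTranspose x := by
    ext a a'
    simp only [mul_apply, conjTranspose_apply, of_apply, one_apply]
    rw [Finset.sum_eq_single (e a - x.1)]
    · by_cases h : a = a'
      · subst h
        simp [Complex.mul_conj', AddChar.norm_apply]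
      · have : e a' ≠ e a := fun h' => h (e.injective h').symm
        simp [h, this]
    · intro k _ hk
      have : e a ≠ k + x.1 := fun h => hk (by simp [h])
      simp [this]
    · simp
  complete a a' k k' := by
    simp only [of_apply, Fintype.sum_prod_type]
    -- Only the shift `g = e a - k` contributes; for it the sum over phases is character
    -- orthogonality.
    have h : ∀ g : G, ∑ ψ : AddChar G ℂ, (if e a = k + g then ψ k else 0) *
        star (if e a' = k' + g then ψ k' else 0) =
        if g = e a - k then (if e a' = k' + g then
          (if k - k' = 0 then (Fintype.card G : ℂ) else 0) else 0) else 0 := by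
      intro g
      rw [← AddChar.sum_apply_eq_ite]
      have hg : g = e a - k ↔ e a = k + g := by
        rw [eq_sub_iff_add_eq', eq_comm]
      simp only [hg]
      split_ifs
      · refine Finset.sum_congr rfl fun ψ _ => ?_
        rw [sub_eq_add_neg, AddChar.map_add_eq_mul, AddChar.map_neg_eq_conj]
        rfl
      all_goals simp
    simp_rw [h, Finset.sum_ite_eq', Finset.mem_univ, if_true, sub_eq_zero]
    by_cases hk : k = k'
    · subst hk
      simp [Fintype.card_congr e, eq_comm]
    · simp [hk]
  card_index := by
    rw [Fintype.card_prod, AddChar.card_eq, Fintype.card_congr e, sq]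
  card_right := (Fintype.card_congr e).symm

/-! ### Compactness of convex hulls and of sets of measurements -/

lemma exists_conjTranspose_mul_self_eq {n : Type*} [Fintype n] [DecidableEq n] {M : Matrix n n ℂ}
    (hM : M.PosSemidef) : ∃ N : Matrix n n ℂ, M = Nᴴ * N := by
  open scoped MatrixOrder in
  obtain ⟨B, hB⟩ := CStarAlgebra.nonneg_iff_eq_star_mul_self.mp hM.nonneg
  exact ⟨B, hB⟩

/-- Carathéodory's theorem with a fixed number of points. -/
lemma convexHull_eq_image_stdSimplex {V : Type*} [AddCommGroup V] [Module ℝ V]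
    [FiniteDimensional ℝ V] (s : Set V) :
    convexHull ℝ s =
      (fun p : (Fin (Module.finrank ℝ V + 1) → ℝ) × (Fin (Module.finrank ℝ V + 1) → V) =>
        ∑ i, p.1 i • p.2 i) '' (stdSimplex ℝ (Fin (Module.finrank ℝ V + 1)) ×ˢ
          Set.univ.pi fun _ => s) := by
  apply Set.Subset.antisymm
  · intro x hx
    obtain ⟨κ, _, z, w, hz, hind, hw, hw1, rfl⟩ := eq_pos_convex_span_of_mem_convexHull hx
    obtain ⟨x₀, hx₀⟩ : s.Nonempty := convexHull_nonempty_iff.1 ⟨_, hx⟩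
    have hcard : Fintype.card κ ≤ Fintype.card (Fin (Module.finrank ℝ V + 1)) := by
      rw [Fintype.card_fin]
      exact hind.card_le_finrank_succ.trans
        (Nat.succ_le_succ (Submodule.finrank_le _))
    obtain ⟨e⟩ := Function.Embedding.nonempty_of_card_le hcard
    -- Unused slots are padded with weight `0` and the arbitrary point `x₀` of `s`.
    refine ⟨(Function.extend e w 0, Function.extend e z fun _ => x₀), ⟨⟨fun i => ?_, ?_⟩, ?_⟩, ?_⟩
    · by_cases hi : ∃ k, e k = i
      · obtain ⟨k, rfl⟩ := hi
        simpa [e.injective.extend_apply] using (hw k).le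
      · simp [Function.extend_apply' _ _ _ hi]
    · have := Fintype.sum_of_injective e e.injective w (Function.extend e w 0)
        (fun i hi => by simp [Function.extend_apply' _ _ _ hi])
        (fun k => by simp [e.injective.extend_apply])
      exact this.symm.trans hw1
    · intro i _
      by_cases hi : ∃ k, e k = i
      · obtain ⟨k, rfl⟩ := hi
        simpa [e.injective.extend_apply] using hz ⟨k, rfl⟩
      · simpa [Function.extend_apply' _ _ _ hi] using hx₀
    · exact (Fintype.sum_of_injective e e.injective (fun k => w k • z k) _
        (fun i hi => by simp [Function.extend_apply' _ _ _ hi])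
        (fun k => by simp [e.injective.extend_apply])).symm
  · rintro _ ⟨⟨w, z⟩, ⟨hw, hz⟩, rfl⟩
    exact (convex_convexHull ℝ s).sum_mem (fun i _ => hw.1 i) hw.2
      fun i _ => subset_convexHull ℝ s (hz i trivial)

lemma isCompact_convexHull_of_isCompact {V : Type*} [NormedAddCommGroup V] [NormedSpace ℝ V]
    [FiniteDimensional ℝ V] {s : Set V} (hs : IsCompact s) : IsCompact (convexHull ℝ s) := by
  rw [convexHull_eq_image_stdSimplex]
  refine ((isCompact_stdSimplex ℝ _).prod (isCompact_univ_pi fun _ => hs)).image ?_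
  fun_prop

/-- Families of matrices, written as functions, whose squares `Mₓᴴ Mₓ` form a POVM. -/
def measurementOperators (X n : Type*) [Fintype X] [Fintype n] [DecidableEq n] :
    Set (X → n → n → ℂ) :=
  {M | ∀ i j, ∑ x, ∑ r, star (M x r i) * M x r j = if i = j then 1 else 0}

/-- The condition is closed, and its diagonal part says that the squared moduli in each column sum
to `1`, which bounds every entry by `1`. -/
lemma isCompact_measurementOperators (X n : Type*) [Fintype X] [Fintype n] [DecidableEq n] :
    IsCompact (measurementOperators X n) := by
  refine Metric.isCompact_of_isClosed_isBounded ?_ ?_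
  · simp only [measurementOperators, Set.ofPred_forall]
    refine isClosed_iInter fun i => isClosed_iInter fun j => isClosed_eq ?_ continuous_const
    fun_prop
  · refine (Metric.isBounded_closedBall (x := (0 : X → n → n → ℂ)) (r := 1)).subset fun M hM => ?_
    rw [mem_closedBall_zero_iff]
    refine (pi_norm_le_iff_of_nonneg zero_le_one).2 fun x =>
      (pi_norm_le_iff_of_nonneg zero_le_one).2 fun r =>
      (pi_norm_le_iff_of_nonneg zero_le_one).2 fun i => ?_
    have h := hM i i
    have h' : ∑ x, ∑ r, ‖M x r i‖ ^ 2 = 1 := by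
      have : ∀ z : ℂ, star z * z = ((‖z‖ ^ 2 : ℝ) : ℂ) := fun z => by
        simpa using Complex.conj_mul' z
      simp only [this, if_true] at h
      exact_mod_cast h
    have h1 : ‖M x r i‖ ^ 2 ≤ 1 := by
      rw [← h']
      refine le_trans ?_ (Finset.single_le_sum (f := fun x => ∑ r, ‖M x r i‖ ^ 2)
        (fun x _ => by positivity) (Finset.mem_univ x))
      exact Finset.single_le_sum (f := fun r => ‖M x r i‖ ^ 2)
        (fun x _ => by positivity) (Finset.mem_univ r)
    exact (sq_le_one_iff₀ (norm_nonneg _)).1 h1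

/-- The POVM `Mₓᴴ Mₓ`. -/
def POVM.ofMeasurementOperators {X n : Type*} [Fintype X] [Fintype n] [DecidableEq n]
    (M : X → n → n → ℂ) (hM : M ∈ measurementOperators X n) : POVM X n where
  effect x := (of (M x))ᴴ * of (M x)
  posSemidef x := posSemidef_conjTranspose_mul_self _
  sum_eq_one := by
    ext i j
    rw [Matrix.sum_apply, one_apply, ← hM i j]
    simp [mul_apply]

lemma POVM.exists_measurementOperators {X n : Type*} [Fintype X] [Fintype n] [DecidableEq n]
    (P : POVM X n) : ∃ M ∈ measurementOperators X n, ∀ x, P.effect x = (of (M x))ᴴ * of (M x) := by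
  choose N hN using fun x => exists_conjTranspose_mul_self_eq (P.posSemidef x)
  refine ⟨fun x => N x, fun i j => ?_, hN⟩
  have := congrFun (congrFun P.sum_eq_one i) j
  rw [Matrix.sum_apply, one_apply] at this
  rw [← this]
  simp [hN, mul_apply]

lemma Channel.exists_of_kraus {κ m n : Type*} [Fintype κ] [Fintype m] [DecidableEq m] [Fintype n]
    (L : κ → Matrix n m ℂ) (hL : ∑ k, (L k)ᴴ * L k = 1) :
    ∃ D : Channel m n, ∀ g : Matrix n m ℂ → ℂ, ∑ j, g (D.kraus j) = ∑ k, g (L k) := by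
  let e := Fintype.equivFin κ
  exact ⟨⟨Fintype.card κ, fun j => L (e.symm j),
    (e.symm.sum_comp fun k => (L k)ᴴ * L k).trans hL⟩,
    fun g => e.symm.sum_comp fun k => g (L k)⟩

/-! ### Teleportation of one system -/

section Choi

variable {A K X C : Type*} [Fintype A] [DecidableEq A] [Fintype K] [DecidableEq K] [Fintype X]

/-- The Choi kernel of teleportation with the measurement `P`: after outcome `x` the unitary
`W x` is applied. -/
noncomputable def choi (W : UnitaryBasis A K X) (P : X → Matrix (K × C) (K × C) ℂ)
    (u u' : A) (a a' : C) : ℂ :=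
  ∑ x, ∑ k, ∑ k', P x (k, a) (k', a') *
    ((Fintype.card A : ℂ)⁻¹ * (W.mat x u k' * star (W.mat x u' k)))

/-- Write `P x = Mₓᴴ Mₓ` and reshape each row of `Mₓ` into a `K × C` matrix `N`. The Kraus operators
are `d^(-1/2) W x N`, with `d` the cardinality of `A`; unitarity removes `W x` from the trace
condition. -/
lemma exists_channel_choi_eq [Fintype C] [DecidableEq C] [Nonempty A]
    (W : UnitaryBasis A K X) (P : POVM X (K × C)) :
    ∃ D : Channel C A, ∀ u u' a a',
      choi W P.effect u u' a a' = ∑ j, D.kraus j u a' * star (D.kraus j u' a) := by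
  obtain ⟨M, hM, hP⟩ := P.exists_measurementOperators
  let N : X × (K × C) → Matrix K C ℂ := fun i => of fun k a => M i.1 i.2 (k, a)
  let c : ℂ := ((√(Fintype.card A : ℝ))⁻¹ : ℝ)
  have hc : star c = c := Complex.conj_ofReal _
  have hcc : c * c = (Fintype.card A : ℂ)⁻¹ := by
    simp only [c, ← Complex.ofReal_mul, ← mul_inv, Real.mul_self_sqrt (Nat.cast_nonneg _)]
    simp
  have hA : (Fintype.card A : ℂ) ≠ 0 := by simp
  have hsum : ∑ i, (c • (W.mat i.1 * N i))ᴴ * (c • (W.mat i.1 * N i)) = 1 := by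
    have h1 : ∀ i, (c • (W.mat i.1 * N i))ᴴ * (c • (W.mat i.1 * N i)) =
        (Fintype.card A : ℂ)⁻¹ • ((N i)ᴴ * N i) := fun i => by
      rw [conjTranspose_smul, conjTranspose_mul, Matrix.smul_mul, Matrix.mul_smul, smul_smul, hc, hcc,
        Matrix.mul_assoc,
        ← Matrix.mul_assoc _ (W.mat i.1), W.conjTranspose_mul, Matrix.one_mul]
    simp_rw [h1, ← Finset.smul_sum]
    ext a a'
    rw [Matrix.smul_apply, Matrix.sum_apply]
    have h2 : ∑ i, ((N i)ᴴ * N i) a a' = ∑ k : K, if a = a' then 1 else 0 := by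
      simp only [mul_apply, conjTranspose_apply, N, of_apply]
      rw [Finset.sum_comm]
      refine Finset.sum_congr rfl fun k _ => ?_
      have := hM (k, a) (k, a')
      simp only [Prod.mk.injEq, true_and] at this
      rw [← this, Fintype.sum_prod_type]
    rw [h2, Finset.sum_const, Finset.card_univ, W.card_right, one_apply]
    split_ifs <;> simp [hA]
  obtain ⟨D, hD⟩ := Channel.exists_of_kraus _ hsum
  refine ⟨D, fun u u' a a' => ?_⟩
  rw [hD fun L => L u a' * star (L u' a), Fintype.sum_prod_type]
  refine Finset.sum_congr rfl fun x _ => ?_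
  simp only [hP, mul_apply, conjTranspose_apply, of_apply, Matrix.smul_apply, smul_eq_mul,
    star_mul', star_sum, hc, N, Finset.sum_mul, Finset.mul_sum, ← hcc]
  simp_rw [Finset.sum_comm (s := (Finset.univ : Finset K)) (t := (Finset.univ : Finset (K × C)))]
  refine Finset.sum_congr rfl fun r _ => ?_
  refine Finset.sum_congr rfl fun k _ => Finset.sum_congr rfl fun k' _ => ?_
  ring

/-- The measurement in the basis of maximally entangled vectors given by a unitary basis. -/
noncomputable def bellMeasurement [Nonempty A] (W : UnitaryBasis A K X) : POVM X (K × A) where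
  effect x := (Fintype.card A : ℂ)⁻¹ •
    vecMulVec (fun i => W.mat x i.2 i.1) (star fun i => W.mat x i.2 i.1)
  posSemidef x := by
    have h : (0 : ℂ) ≤ (Fintype.card A : ℂ)⁻¹ := by
      rw [← Complex.ofReal_natCast, ← Complex.ofReal_inv]
      exact Complex.zero_le_real.2 (inv_nonneg.2 (Nat.cast_nonneg _))
    exact (posSemidef_vecMulVec_self_star _).smul h
  sum_eq_one := by
    have hA : (Fintype.card A : ℂ) ≠ 0 := by simp
    ext i j
    rw [← Finset.smul_sum, Matrix.smul_apply, Matrix.sum_apply]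
    simp only [vecMulVec_apply, Pi.star_apply, W.complete, one_apply, smul_eq_mul, Prod.ext_iff,
      and_comm]
    split_ifs <;> simp [hA]

/-- Unitarity of `W x` makes each of the `d²` outcomes contribute the identity kernel divided by
`d²`. -/
lemma choi_bellMeasurement [Nonempty A] (W : UnitaryBasis A K X) (u u' a a' : A) :
    choi W (bellMeasurement W).effect u u' a a' =
      (if u = a' then 1 else 0) * (if a = u' then 1 else 0) := by
  have hA : (Fintype.card A : ℂ) ≠ 0 := by simp
  have h : ∀ x, ∑ k, ∑ k', (bellMeasurement W).effect x (k, a) (k', a') *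
      ((Fintype.card A : ℂ)⁻¹ * (W.mat x u k' * star (W.mat x u' k))) =
      (Fintype.card A : ℂ)⁻¹ ^ 2 * ((W.mat x * (W.mat x)ᴴ) u a' * (W.mat x * (W.mat x)ᴴ) a u') := by
    intro x
    simp only [bellMeasurement, Matrix.smul_apply, vecMulVec_apply, smul_eq_mul, Pi.star_apply,
      mul_apply, conjTranspose_apply, Finset.sum_mul, Finset.mul_sum]
    refine Finset.sum_congr rfl fun k _ => Finset.sum_congr rfl fun k' _ => ?_
    ring
  simp only [choi, h, W.mul_conjTranspose, Finset.sum_const, Finset.card_univ, W.card_index,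
    one_apply, nsmul_eq_mul]
  push_cast
  rw [← mul_assoc, ← mul_pow, mul_inv_cancel₀ hA, one_pow, one_mul]

end Choi

/-! ### Teleportation of both systems -/

section Output

variable {A K X C B L Y D : Type*} [Fintype A] [DecidableEq A] [Fintype K] [DecidableEq K]
  [Fintype X] [Fintype C] [DecidableEq C] [Fintype B] [DecidableEq B] [Fintype L] [DecidableEq L]
  [Fintype Y] [Fintype D] [DecidableEq D]

/-- The output of teleporting both halves of `ρ` with the measurements `P` and `Q`. -/
noncomputable def teleport (W : UnitaryBasis A K X) (V : UnitaryBasis B L Y)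
    (P : X → Matrix (K × C) (K × C) ℂ) (Q : Y → Matrix (D × L) (D × L) ℂ)
    (ρ : Matrix (C × D) (C × D) ℂ) : Matrix (A × B) (A × B) ℂ :=
  of fun p q => ∑ a, ∑ a', ∑ b, ∑ b', ρ (a', b') (a, b) * choi W P p.1 q.1 a a' *
    choi V (fun y => (Q y).submatrix Prod.swap Prod.swap) p.2 q.2 b b'

/-- The POVM with the two tensor factors exchanged. -/
def POVM.swap (Q : POVM Y (D × L)) : POVM Y (L × D) where
  effect y := (Q.effect y).submatrix Prod.swap Prod.swap
  posSemidef y := (Q.posSemidef y).submatrix _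
  sum_eq_one := by
    ext i j
    have := congrFun (congrFun Q.sum_eq_one i.swap) j.swap
    rw [Matrix.sum_apply] at this ⊢
    simpa [one_apply, Prod.swap_inj] using this

lemma exists_localApply_eq_teleport [Nonempty A] [Nonempty B] (W : UnitaryBasis A K X)
    (V : UnitaryBasis B L Y) (P : POVM X (K × C)) (Q : POVM Y (D × L))
    (ρ : Matrix (C × D) (C × D) ℂ) :
    ∃ (F : Channel C A) (G : Channel D B),
      teleport W V P.effect Q.effect ρ = localApply F G ρ := by
  obtain ⟨F, hF⟩ := exists_channel_choi_eq W P
  obtain ⟨G, hG⟩ := exists_channel_choi_eq V Q.swap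
  refine ⟨F, G, ?_⟩
  ext p q
  have hG' := hG
  simp only [POVM.swap] at hG'
  simp only [teleport, of_apply, hF, hG', localApply, Matrix.sum_apply, mul_apply, kroneckerMap_apply,
    conjTranspose_apply, Fintype.sum_prod_type, Finset.sum_mul, Finset.mul_sum, star_mul']
  -- Each exchange is oriented by index type, bringing both sides to one summation order for a
  -- termwise comparison.
  simp_rw [Finset.sum_comm (s := (Finset.univ : Finset D)) (t := (Finset.univ : Finset C)),
    Finset.sum_comm (s := (Finset.univ : Finset (Fin G.rank)))
      (t := (Finset.univ : Finset (Fin F.rank))),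
    Finset.sum_comm (s := (Finset.univ : Finset D)) (t := (Finset.univ : Finset (Fin F.rank))),
    Finset.sum_comm (s := (Finset.univ : Finset C)) (t := (Finset.univ : Finset (Fin F.rank))),
    Finset.sum_comm (s := (Finset.univ : Finset D)) (t := (Finset.univ : Finset (Fin G.rank))),
    Finset.sum_comm (s := (Finset.univ : Finset C)) (t := (Finset.univ : Finset (Fin G.rank)))]
  refine Finset.sum_congr rfl fun j _ => Finset.sum_congr rfl fun k _ =>
    Finset.sum_congr rfl fun a _ => Finset.sum_congr rfl fun a' _ =>
    Finset.sum_congr rfl fun b _ => Finset.sum_congr rfl fun b' _ => ?_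
  ring

lemma teleport_bellMeasurement [Nonempty A] [Nonempty B] (W : UnitaryBasis A K X)
    (V : UnitaryBasis B L Y) (ρ : Matrix (A × B) (A × B) ℂ) :
    teleport W V (bellMeasurement W).effect (bellMeasurement V).swap.effect ρ = ρ := by
  ext p q
  have h : (fun y => ((bellMeasurement V).swap.effect y).submatrix Prod.swap Prod.swap) =
      (bellMeasurement V).effect := by
    ext; simp [POVM.swap]
  simp only [teleport, of_apply, h, choi_bellMeasurement]
  simp

end Output

/-! ### Payoffs as functionals of the teleported state -/

section Payoff

variable {A K X C B L Y D S T : Type*} [Fintype K] [Fintype X] [Fintype L] [Fintype Y]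
  [Fintype S] [Fintype T]

lemma trace_kronecker_mul_jointOperator [Fintype C] [Fintype D] (P : Matrix (K × C) (K × C) ℂ)
    (Q : Matrix (D × L) (D × L) ℂ) (ζ : Matrix K K ℂ) (ρ : Matrix (C × D) (C × D) ℂ)
    (η : Matrix L L ℂ) :
    ((P ⊗ₖ Q) * jointOperator ζ ρ η).trace =
      ∑ c : (C × C) × (D × D), ρ (c.1.2, c.2.2) (c.1.1, c.2.1) *
        (∑ k, ∑ k', P (k, c.1.1) (k', c.1.2) * ζ k' k) *
        (∑ l, ∑ l', Q (c.2.1, l) (c.2.2, l') * η l' l) := by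
  simp only [trace, diag, mul_apply, kroneckerMap_apply, jointOperator, submatrix_apply,
    Fintype.sum_prod_type, Finset.sum_mul, Finset.mul_sum]
  simp_rw [Finset.sum_comm (s := (Finset.univ : Finset L)) (t := (Finset.univ : Finset K)),
    Finset.sum_comm (s := (Finset.univ : Finset D)) (t := (Finset.univ : Finset K)),
    Finset.sum_comm (s := (Finset.univ : Finset C)) (t := (Finset.univ : Finset K)),
    Finset.sum_comm (s := (Finset.univ : Finset L)) (t := (Finset.univ : Finset C)),
    Finset.sum_comm (s := (Finset.univ : Finset D)) (t := (Finset.univ : Finset C)),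
    Finset.sum_comm (s := (Finset.univ : Finset L)) (t := (Finset.univ : Finset D))]
  refine Finset.sum_congr rfl fun k _ => Finset.sum_congr rfl fun k' _ =>
    Finset.sum_congr rfl fun a _ => Finset.sum_congr rfl fun a' _ =>
    Finset.sum_congr rfl fun b _ => Finset.sum_congr rfl fun b' _ =>
    Finset.sum_congr rfl fun l _ => Finset.sum_congr rfl fun l' _ => ?_
  ring

/-- The separating functional is only real-linear, so probabilities must be real scalars to pass
through it. -/
lemma trace_kronecker_mul_jointOperator_eq_re [Fintype C] [Fintype D]
    {P : Matrix (K × C) (K × C) ℂ}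
    {Q : Matrix (D × L) (D × L) ℂ} {ζ : Matrix K K ℂ} {ρ : Matrix (C × D) (C × D) ℂ}
    {η : Matrix L L ℂ} (hP : P.IsHermitian) (hQ : Q.IsHermitian) (hζ : ζ.IsHermitian)
    (hρ : ρ.IsHermitian) (hη : η.IsHermitian) :
    ((P ⊗ₖ Q) * jointOperator ζ ρ η).trace =
      ((((P ⊗ₖ Q) * jointOperator ζ ρ η).trace.re : ℝ) : ℂ) := by
  have hJ : (jointOperator ζ ρ η).IsHermitian := by
    refine IsHermitian.submatrix ?_ _
    rw [IsHermitian, conjTranspose_kronecker, conjTranspose_kronecker, hζ.eq, hρ.eq, hη.eq]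
  have hPQ : (P ⊗ₖ Q)ᴴ = P ⊗ₖ Q := by rw [conjTranspose_kronecker, hP.eq, hQ.eq]
  have h : star ((P ⊗ₖ Q) * jointOperator ζ ρ η).trace =
      ((P ⊗ₖ Q) * jointOperator ζ ρ η).trace := by
    rw [← trace_conjTranspose, conjTranspose_mul, hPQ, hJ.eq, trace_mul_comm]
  exact (Complex.conj_eq_iff_re.1 h).symm

lemma sum_factor {I : Type*} [Fintype I] (r : I → ℂ) (p : S → X → I → ℂ) (q : T → Y → I → ℂ)
    (m : S → X → ℂ) (n : T → Y → ℂ) :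
    ∑ s, ∑ t, ∑ x, ∑ y, (∑ c, r c * p s x c * q t y c) * (m s x * n t y) =
      ∑ c, r c * (∑ x, ∑ s, p s x c * m s x) * (∑ y, ∑ t, q t y c * n t y) := by
  simp only [Finset.sum_mul, Finset.mul_sum]
  simp_rw [Finset.sum_comm (t := (Finset.univ : Finset I))]
  refine Finset.sum_congr rfl fun c _ => ?_
  simp_rw [Finset.sum_comm (s := (Finset.univ : Finset T)) (t := (Finset.univ : Finset X)),
    Finset.sum_comm (s := (Finset.univ : Finset T)) (t := (Finset.univ : Finset Y)),
    Finset.sum_comm (s := (Finset.univ : Finset T)) (t := (Finset.univ : Finset S)),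
    Finset.sum_comm (s := (Finset.univ : Finset S)) (t := (Finset.univ : Finset X)),
    Finset.sum_comm (s := (Finset.univ : Finset S)) (t := (Finset.univ : Finset Y)),
    Finset.sum_comm (s := (Finset.univ : Finset Y)) (t := (Finset.univ : Finset X))]
  refine Finset.sum_congr rfl fun x _ => Finset.sum_congr rfl fun y _ =>
    Finset.sum_congr rfl fun s _ => Finset.sum_congr rfl fun t _ => ?_
  ring

variable [Fintype A] [DecidableEq A] [DecidableEq K] [Fintype B] [DecidableEq B] [DecidableEq L]

/-- The contribution to the output of teleportation of outcome `x` with the matrix `R`, an element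
of the frame dual to the question states. -/
noncomputable def UnitaryBasis.conj (W : UnitaryBasis A K X) (R : Matrix K K ℂ) (x : X) :
    Matrix A A ℂ :=
  (Fintype.card A : ℂ)⁻¹ • (W.mat x * R * (W.mat x)ᴴ)

/-- By duality `∑ s, ζ s ⊗ R s` is the unnormalized maximally entangled projector, so summing over
questions supplies the teleportation resource; the factor in `UnitaryBasis.conj` normalizes it. -/
lemma choi_eq_sum_dual_frame (W : UnitaryBasis A K X) {ζ R : S → Matrix K K ℂ}
    (hζ : ∀ i j k l, ∑ s, ζ s i j * R s k l = if i = k ∧ j = l then 1 else 0)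
    (P : X → Matrix (K × C) (K × C) ℂ) (u u' : A) (a a' : C) :
    ∑ x, ∑ s, (∑ k, ∑ k', P x (k, a) (k', a') * ζ s k' k) * W.conj (R s) x u u' =
      choi W P u u' a a' := by
  refine Finset.sum_congr rfl fun x _ => ?_
  simp_rw [Finset.sum_mul]
  rw [Finset.sum_comm]
  refine Finset.sum_congr rfl fun k _ => ?_
  rw [Finset.sum_comm]
  refine Finset.sum_congr rfl fun k' _ => ?_
  simp_rw [mul_assoc]
  rw [← Finset.mul_sum]
  congr 1
  simp only [UnitaryBasis.conj, Matrix.smul_apply, smul_eq_mul, mul_apply, conjTranspose_apply,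
    Finset.mul_sum, Finset.sum_mul]
  rw [Finset.sum_comm]
  have h : ∀ m m', ∑ s, ζ s k' k * ((Fintype.card A : ℂ)⁻¹ *
      (W.mat x u m * R s m m' * star (W.mat x u' m'))) =
      if k' = m ∧ k = m' then
        (Fintype.card A : ℂ)⁻¹ * (W.mat x u m * star (W.mat x u' m')) else 0 := by
    intro m m'
    rw [← mul_boole, ← hζ, Finset.mul_sum]
    exact Finset.sum_congr rfl fun s _ => by ring
  simp_rw [Finset.sum_comm (s := (Finset.univ : Finset S)), h, ite_and]
  simp

lemma sum_trace_smul_eq_teleport [Fintype C] [Fintype D] (W : UnitaryBasis A K X)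
    (V : UnitaryBasis B L Y)
    {ζ R : S → Matrix K K ℂ} {η R' : T → Matrix L L ℂ}
    (hζ : ∀ i j k l, ∑ s, ζ s i j * R s k l = if i = k ∧ j = l then 1 else 0)
    (hη : ∀ i j k l, ∑ t, η t i j * R' t k l = if i = k ∧ j = l then 1 else 0)
    (P : X → Matrix (K × C) (K × C) ℂ) (Q : Y → Matrix (D × L) (D × L) ℂ)
    (ρ : Matrix (C × D) (C × D) ℂ) :
    ∑ s, ∑ t, ∑ x, ∑ y, ((P x ⊗ₖ Q y) * jointOperator (ζ s) ρ (η t)).trace •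
      (W.conj (R s) x ⊗ₖ V.conj (R' t) y) = teleport W V P Q ρ := by
  ext p q
  simp only [Matrix.sum_apply, Matrix.smul_apply, kroneckerMap_apply, smul_eq_mul,
    trace_kronecker_mul_jointOperator]
  rw [sum_factor (fun c : (C × C) × (D × D) => ρ (c.1.2, c.2.2) (c.1.1, c.2.1))
    (fun s x c => ∑ k, ∑ k', P x (k, c.1.1) (k', c.1.2) * ζ s k' k)
    (fun t y c => ∑ l, ∑ l', Q y (c.2.1, l) (c.2.2, l') * η t l' l)
    (fun s x => W.conj (R s) x p.1 q.1) (fun t y => V.conj (R' t) y p.2 q.2)]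
  simp only [choi_eq_sum_dual_frame W hζ]
  have := choi_eq_sum_dual_frame V hη (fun y => (Q y).submatrix Prod.swap Prod.swap) p.2 q.2
  simp only [submatrix_apply, Prod.swap_prod_mk] at this
  simp only [this, Fintype.sum_prod_type, teleport, of_apply]

end Payoff

/-- The game whose average payoff is the value of the functional `f` on the teleported state. -/
noncomputable def teleportGame {A B : Type*} [Fintype A] [DecidableEq A] [Fintype B]
    [DecidableEq B] {K X L Y S T : Type} [Fintype K] [DecidableEq K] [Fintype X] [Nonempty X]
    [Fintype L] [DecidableEq L] [Fintype Y] [Nonempty Y] [Fintype S] [Nonempty S] [Fintype T]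
    [Nonempty T] (W : UnitaryBasis A K X) (V : UnitaryBasis B L Y) (ζ : S → State K)
    (η : T → State L) (R : S → Matrix K K ℂ) (R' : T → Matrix L L ℂ)
    (f : Matrix (A × B) (A × B) ℂ →ₗ[ℝ] ℝ) : Game where
  S := S
  T := T
  X := X
  Y := Y
  K := K
  L := L
  p _ := (Fintype.card S : ℝ)⁻¹
  q _ := (Fintype.card T : ℝ)⁻¹
  p_nonneg _ := by positivity
  q_nonneg _ := by positivity
  p_sum := by simp
  q_sum := by simp
  ζ := ζ
  η := η
  payoff s t x y := Fintype.card S * Fintype.card T * f (W.conj (R s) x ⊗ₖ V.conj (R' t) y)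

/-- The cardinalities in the payoff cancel the uniform question distributions. The `R s` need not be
Hermitian, since `f` is real-valued on all complex matrices. -/
lemma averagePayoff_teleportGame {A B C D : Type*} [Fintype A] [DecidableEq A] [Fintype B]
    [DecidableEq B] [Fintype C] [DecidableEq C] [Fintype D] [DecidableEq D]
    {K X L Y S T : Type} [Fintype K] [DecidableEq K] [Fintype X] [Nonempty X]
    [Fintype L] [DecidableEq L] [Fintype Y] [Nonempty Y] [Fintype S] [Nonempty S] [Fintype T]
    [Nonempty T] (W : UnitaryBasis A K X) (V : UnitaryBasis B L Y) (ζ : S → State K)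
    (η : T → State L) {R : S → Matrix K K ℂ} {R' : T → Matrix L L ℂ}
    (hζ : ∀ i j k l, ∑ s, (ζ s).mat i j * R s k l = if i = k ∧ j = l then 1 else 0)
    (hη : ∀ i j k l, ∑ t, (η t).mat i j * R' t k l = if i = k ∧ j = l then 1 else 0)
    (f : Matrix (A × B) (A × B) ℂ →ₗ[ℝ] ℝ) (ρ : State (C × D)) (P : POVM X (K × C))
    (Q : POVM Y (D × L)) :
    (teleportGame W V ζ η R R' f).averagePayoff ρ P Q =
      f (teleport W V P.effect Q.effect ρ.mat) := by
  rw [← sum_trace_smul_eq_teleport W V (ζ := fun s => (ζ s).mat) (η := fun t => (η t).mat) hζ hη]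
  simp only [map_sum]
  refine Finset.sum_congr rfl fun s _ => Finset.sum_congr rfl fun t _ =>
    Finset.sum_congr rfl fun x _ => Finset.sum_congr rfl fun y _ => ?_
  rw [trace_kronecker_mul_jointOperator_eq_re (P.posSemidef x).1 (Q.posSemidef y).1
    (ζ s).posSemidef.1 ρ.posSemidef.1 (η t).posSemidef.1, Complex.coe_smul, map_smul, smul_eq_mul]
  have hS : (Fintype.card S : ℝ) ≠ 0 := by simp
  have hT : (Fintype.card T : ℝ) ≠ 0 := by simp
  change (Fintype.card S : ℝ)⁻¹ * (Fintype.card T : ℝ)⁻¹ * (Fintype.card S * Fintype.card T *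
    f (W.conj (R s) x ⊗ₖ V.conj (R' t) y)) *
    ((P.effect x ⊗ₖ Q.effect y) * jointOperator (ζ s).mat ρ.mat (η t).mat).trace.re = _
  field_simp

lemma State.nonempty {A B : Type*} [Fintype A] [Fintype B] (ρ : State (A × B)) :
    Nonempty A ∧ Nonempty B := by
  rw [← nonempty_prod]
  by_contra h
  rw [not_nonempty_iff] at h
  simpa [trace] using ρ.trace_eq_one

/-! ### The set of teleported operators -/

section Reachable

variable {A K X C B L Y D : Type*} [Fintype A] [DecidableEq A] [Fintype K] [DecidableEq K]
  [Fintype X] [Fintype C] [DecidableEq C] [Fintype B] [DecidableEq B] [Fintype L] [DecidableEq L]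
  [Fintype Y] [Fintype D] [DecidableEq D]

/-- The operators obtained from `ρ` by teleportation with arbitrary measurements. -/
def teleportSet (W : UnitaryBasis A K X) (V : UnitaryBasis B L Y)
    (ρ : Matrix (C × D) (C × D) ℂ) : Set (A × B → A × B → ℂ) :=
  {τ | ∃ (P : POVM X (K × C)) (Q : POVM Y (D × L)), teleport W V P.effect Q.effect ρ = of τ}

lemma isCompact_teleportSet (W : UnitaryBasis A K X) (V : UnitaryBasis B L Y)
    (ρ : Matrix (C × D) (C × D) ℂ) : IsCompact (teleportSet W V ρ) := by
  have h : teleportSet W V ρ =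
      (fun MN : (X → K × C → K × C → ℂ) × (Y → D × L → D × L → ℂ) =>
        of.symm (teleport W V (fun x => (of (MN.1 x))ᴴ * of (MN.1 x))
          (fun y => (of (MN.2 y))ᴴ * of (MN.2 y)) ρ)) ''
        (measurementOperators X (K × C) ×ˢ measurementOperators Y (D × L)) := by
    ext τ
    constructor
    · rintro ⟨P, Q, h⟩
      obtain ⟨M, hM, hP⟩ := P.exists_measurementOperators
      obtain ⟨N, hN, hQ⟩ := Q.exists_measurementOperators
      refine ⟨(M, N), ⟨hM, hN⟩, ?_⟩
      simp only [← hP, ← hQ]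
      exact (Equiv.symm_apply_eq _).2 h
    · rintro ⟨⟨M, N⟩, ⟨hM, hN⟩, rfl⟩
      exact ⟨.ofMeasurementOperators M hM, .ofMeasurementOperators N hN, rfl⟩
  rw [h]
  refine ((isCompact_measurementOperators _ _).prod (isCompact_measurementOperators _ _)).image ?_
  refine continuous_pi fun p => continuous_pi fun q => ?_
  simp only [teleport, choi, of_symm_apply, of_apply, submatrix_apply, mul_apply,
    conjTranspose_apply]
  fun_prop

/-- The weights of the convex combination serve as the shared randomness. -/
lemma LOSRConvertible.of_mem_convexHull [Nonempty A] [Nonempty B] (W : UnitaryBasis A K X)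
    (V : UnitaryBasis B L Y) (σ : State (C × D)) (τ : State (A × B))
    (h : of.symm τ.mat ∈ convexHull ℝ (teleportSet W V σ.mat)) : LOSRConvertible σ τ := by
  obtain ⟨κ, _, w, z, hw, hw1, hz, hτ⟩ := mem_convexHull_iff_exists_fintype.1 h
  have : ∀ k, ∃ (F : Channel C A) (G : Channel D B), of (z k) = localApply F G σ.mat := fun k => by
    obtain ⟨P, Q, hk⟩ := hz k
    rw [← hk]
    exact exists_localApply_eq_teleport W V P Q σ.mat
  choose F G hFG using this
  let e := Fintype.equivFin κ
  refine ⟨Fintype.card κ, fun i => w (e.symm i), fun i => F (e.symm i), fun i => G (e.symm i),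
    fun i => hw _, (e.symm.sum_comp w).trans hw1, ?_⟩
  rw [e.symm.sum_comp fun k => (w k : ℂ) • localApply (F k) (G k) σ.mat]
  simp_rw [← hFG]
  ext p q
  have := congrFun (congrFun hτ p) q
  simpa [Matrix.sum_apply] using this.symm

end Reachable

/-! ### Comparison of states by games, and the theorem -/

/-- A state that is at least as good as `τ` in all semiquantum nonlocal games can be transformed
into `τ` by local operations and shared randomness. -/
theorem losrConvertible_of_forall_maxPayoff_le {A B C D : Type*} [Fintype A] [DecidableEq A]
    [Fintype B] [DecidableEq B] [Fintype C] [DecidableEq C] [Fintype D] [DecidableEq D]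
    (σ : State (C × D)) (τ : State (A × B)) (h : ∀ G : Game, G.maxPayoff τ ≤ G.maxPayoff σ) :
    LOSRConvertible σ τ := by
  obtain ⟨_, _⟩ := τ.nonempty
  -- The question spaces are indexed by `ZMod`, which lies in `Type` as `Game` demands, whatever the
  -- universes of `A` and `B`.
  let W := weylBasis ((Fintype.equivFin A).trans (ZMod.finEquiv (Fintype.card A)).toEquiv)
  let V := weylBasis ((Fintype.equivFin B).trans (ZMod.finEquiv (Fintype.card B)).toEquiv)
  obtain ⟨ζ, R, hζ⟩ := exists_state_dual_frame (ZMod (Fintype.card A))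
  obtain ⟨η, R', hη⟩ := exists_state_dual_frame (ZMod (Fintype.card B))
  refine LOSRConvertible.of_mem_convexHull W V σ τ ?_
  by_contra hτ
  obtain ⟨f, u, hu, hfτ⟩ := geometric_hahn_banach_closed_point (convex_convexHull ℝ _)
    (isCompact_convexHull_of_isCompact (isCompact_teleportSet W V σ.mat)).isClosed hτ
  let g : Matrix (A × B) (A × B) ℂ →ₗ[ℝ] ℝ :=
    f.toLinearMap ∘ₗ (Matrix.ofLinearEquiv ℝ).symm.toLinearMap
  let G := teleportGame W V ζ η R R' g
  have hσ : G.maxPayoff σ ≤ (u : EReal) := by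
    refine iSup₂_le fun P Q => EReal.coe_le_coe_iff.2 ?_
    exact (averagePayoff_teleportGame W V ζ η hζ hη g σ P Q).trans_le
      (hu _ (subset_convexHull ℝ _ ⟨P, Q, rfl⟩)).le
  have hτ' : ((f (of.symm τ.mat) : ℝ) : EReal) ≤ G.maxPayoff τ := by
    have hB := averagePayoff_teleportGame W V ζ η hζ hη g τ (bellMeasurement W)
      (bellMeasurement V).swap
    rw [teleport_bellMeasurement] at hB
    exact le_iSup₂_of_le (bellMeasurement W) (bellMeasurement V).swap
      (EReal.coe_le_coe_iff.2 hB.ge)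
  exact absurd (hτ'.trans ((h G).trans hσ)) (not_le.2 (EReal.coe_lt_coe_iff.2 hfτ))

end Semiquantum

theorem mainTheorem1 {ι : Type*} {A B : ι → Type*}
    [∀ i, Fintype (A i)] [∀ i, DecidableEq (A i)]
    [∀ i, Fintype (B i)] [∀ i, DecidableEq (B i)]
    (E : (i : ι) → Semiquantum.State (A i × B i) → EReal)
    (hE : Semiquantum.LOSRMonotone E)
    {i j : ι} (R : Semiquantum.POVMSet (A i × B i))
    (ρ : Semiquantum.State (A i × B i)) (ρbar : Semiquantum.State (A j × B j))
    (h : ∀ G : Semiquantum.Game, G.maxPayoff ρbar = G.restrictedMaxPayoff R ρ) :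
    Semiquantum.effectiveEntanglement E R ρ = E j ρbar := by
  apply le_antisymm
  · exact sInf_le ⟨⟨j, ρbar⟩, fun G => (h G).ge, rfl⟩
  · refine le_sInf ?_
    rintro _ ⟨⟨k, σ⟩, hσ, rfl⟩
    exact hE k j σ ρbar (Semiquantum.losrConvertible_of_forall_maxPayoff_le σ ρbar
      fun G => (h G).trans_le (hσ G))
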